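/- Let $m,n$ be nonnegative integers, let $\mathcal{B}\subseteq\binom{[m]}{n}$ be the family of bases of a matroid on the ground set $[m]=\{1,\dots,m\}$, and let $\mathcal{B}^\star=\{[m]\setminus S : S\in\mathcal{B}\}$ be the family of bases of the dual matroid. A polynomial $p\in\mathbb{R}[x_1,\dots,x_m]$ is called real stable if $p(z)\neq 0$ for all $z\in\mathbb{C}^m$ with $\operatorname{Im}(z_i)>0$ for every $i$. A probability distribution $\mu$ on the subsets of $[m]$ is called strongly Rayleigh if its generating polynomial $\sum_{S\subseteq[m]}\mu(S)\prod_{i\in S}x_i$ is real stable. For a polynomial $p$ with nonnegative coefficients let $p_{\mathcal{B}}$ be the sum over $S\in\mathcal{B}$ of the coefficient of $\prod_{i\in S}x_i$ in $p$, let $P(\mathcal{B})\subseteq\mathbb{R}^m$ be the convex hull of the characteristic vectors $1_S$, $S\in\mathcal{B}$, and let $$\mathrm{Cap}_{\mathcal{B}}(p)=\sup_{\theta\in P(\mathcal{B})}\ \inf_{z\in\mathbb{R}_{>0}^m}\ \frac{p(z)}{\prod_{i=1}^m z_i^{\theta_i}} .$$ Let $M(\mathcal{B})$ be the supremum of $\mathrm{Cap}_{\mathcal{B}}(p)/p_{\mathcal{B}}$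 over all real stable, $n$-homogeneous polynomials $p\in\mathbb{R}[x_1,\dots,x_m]$ with nonnegative coefficients and $p_{\mathcal{B}}>0$. If there exists a strongly Rayleigh distribution whose support $\{S\subseteq[m]:\mu(S)>0\}$ is exactly $\mathcal{B}^\star$, then $M(\mathcal{B})<\infty$. -/

import Mathlib

namespace MatroidCapacity

open MvPolynomial

noncomputable section

/-- A real polynomial is real stable if it has no zero `z ∈ ℂ^m` all of whose coordinates have
positive imaginary part. -/
def IsRealStable {m : ℕ} (p : MvPolynomial (Fin m) ℝ) : Prop :=
  ∀ z : Fin m → ℂ, (∀ i, 0 < (z i).im) → aeval z p ≠ 0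

/-- All coefficients of the polynomial are nonnegative. -/
def NonnegCoeffs {m : ℕ} (p : MvPolynomial (Fin m) ℝ) : Prop :=
  ∀ α : Fin m →₀ ℕ, 0 ≤ p.coeff α

/-- The exponent vector `1_S` of the square-free monomial `x^S = ∏ i ∈ S, x_i`. -/
def expVec {m : ℕ} (S : Finset (Fin m)) : Fin m →₀ ℕ :=
  ∑ i ∈ S, Finsupp.single i 1

/-- `p_𝓑`: the sum of the coefficients of `x^S` in `p` over all `S ∈ 𝓑`. -/
def coeffSum {m : ℕ} (𝓑 : Finset (Finset (Fin m))) (p : MvPolynomial (Fin m) ℝ) : ℝ :=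
  ∑ S ∈ 𝓑, p.coeff (expVec S)

/-- `P(𝓑)`: the convex hull in `ℝ^m` of the characteristic vectors `1_S`, `S ∈ 𝓑`. -/
def polytope {m : ℕ} (𝓑 : Finset (Finset (Fin m))) : Set (Fin m → ℝ) :=
  convexHull ℝ ((fun S : Finset (Fin m) => fun i => if i ∈ S then (1 : ℝ) else 0) '' (𝓑 : Set _))

/-- The `𝓑`-capacity `sup_{θ ∈ P(𝓑)} inf_{z > 0} p(z) / ∏ z_i^{θ_i}`, the supremum and the infimum
being taken in the extended real line. -/
def capacity {m : ℕ} (𝓑 : Finset (Finset (Fin m))) (p : MvPolynomial (Fin m) ℝ) : EReal :=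
  ⨆ θ ∈ polytope 𝓑, ⨅ (z : Fin m → ℝ) (_ : ∀ i, 0 < z i),
    ((eval z p / ∏ i, z i ^ θ i : ℝ) : EReal)

/-- The approximation ratio `M(𝓑)` of a family `𝓑` of `n`-element sets: the supremum, in the
extended real line, of `Cap_𝓑(p) / p_𝓑` over the real stable, `n`-homogeneous polynomials `p` with
nonnegative coefficients and `p_𝓑 > 0`. -/
def approxRatio {m : ℕ} (n : ℕ) (𝓑 : Finset (Finset (Fin m))) : EReal :=
  ⨆ (p : MvPolynomial (Fin m) ℝ)
    (_ : NonnegCoeffs p ∧ IsRealStable p ∧ p.IsHomogeneous n ∧ 0 < coeffSum 𝓑 p),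
    capacity 𝓑 p / (coeffSum 𝓑 p : EReal)

/-- The generating polynomial `∑_S μ(S) x^S` of a distribution on the subsets of `Fin m`. -/
def genPoly {m : ℕ} (μ : PMF (Finset (Fin m))) : MvPolynomial (Fin m) ℝ :=
  ∑ S : Finset (Fin m), monomial (expVec S) (μ S).toReal

/-- A distribution is strongly Rayleigh if its generating polynomial is real stable. -/
def IsStronglyRayleigh {m : ℕ} (μ : PMF (Finset (Fin m))) : Prop :=
  IsRealStable (genPoly μ)

end

end MatroidCapacity

/-! Let `g` be the generating polynomial of `μ` and `ε > 0` its least mass on the complements of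
bases. For admissible `p`, the product `p * g` is again stable and homogeneous with nonnegative
coefficients. Its coefficient at `x₁ ⋯ x_m` is `∑ p_S μ(Sᶜ) ≤ p_𝓑` (`coeff_mul_genPoly_le`), while
`g(z) ≥ ε z^(1 - θ)` for `θ ∈ P(𝓑)` (`mul_prod_le_eval_genPoly_mul`), so `p g / (x₁ ⋯ x_m) ≥ ε p /
z^θ`. Gurvits' inequality (`IsHurwitzStable.le_exp_mul_coeff`) compares the two and bounds the ratio
by `eᵐ / ε`, uniformly in `p`.

Gurvits' inequality is proved by extracting one variable at a time: each step costs a factor `e` by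
a univariate estimate and preserves stability. -/

namespace MatroidCapacity

/-! ### Real-rooted univariate polynomials -/

section Univariate

open Polynomial

theorem splits_of_forall_im_eq_zero {g : ℝ[X]} (h : ∀ z : ℂ, aeval z g = 0 → z.im = 0) :
    g.Splits := by
  refine Splits.of_splits_map (algebraMap ℝ ℂ) (IsAlgClosed.splits _) fun z hz => ?_
  have hz' := (mem_roots'.1 hz).2
  rw [IsRoot.def, eval_map_algebraMap] at hz'
  exact ⟨z.re, Complex.ext (by simp) (by simp [h z hz'])⟩

/-- Factor by factor: `|a| ≤ |i - a|` for each real root `a`. -/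
theorem abs_eval_zero_le_norm_aeval_I {g : ℝ[X]} (hg : g.Splits) :
    |g.eval 0| ≤ ‖aeval Complex.I g‖ := by
  have h1 := hg.eval_eq_prod_roots 0
  have h2 := (hg.map (algebraMap ℝ ℂ)).aeval_eq_prod_aroots Complex.I
  rw [h1, h2, aroots_def, hg.roots_map, abs_mul, norm_mul, Multiset.map_map]
  have key : ∀ s : Multiset ℝ, |(s.map fun a => 0 - a).prod| ≤
      ‖(s.map ((fun a => Complex.I - a) ∘ algebraMap ℝ ℂ)).prod‖ := by
    intro s
    induction s using Multiset.induction_on with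
    | empty => simp
    | cons a s ih =>
      rw [Multiset.map_cons, Multiset.map_cons, Multiset.prod_cons, Multiset.prod_cons, abs_mul,
        norm_mul]
      refine mul_le_mul ?_ ih (abs_nonneg _) (norm_nonneg _)
      have := Complex.abs_re_le_norm (Complex.I - (a : ℂ))
      simpa using this
  have : ‖algebraMap ℝ ℂ g.leadingCoeff‖ = |g.leadingCoeff| := by simp
  rw [this]
  exact mul_le_mul_of_nonneg_left (key _) (abs_nonneg _)

/-- A univariate real-rooted polynomial with nonnegative coefficients lies below the exponential
with the same `1`-jet at `0`. -/
theorem eval_le_mul_exp {g : ℝ[X]} (hg : g.Splits) (hc : ∀ k, 0 ≤ g.coeff k)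
    (h0 : 0 < g.coeff 0) {t : ℝ} (ht : 0 ≤ t) :
    g.eval t ≤ g.coeff 0 * Real.exp (t * (g.coeff 1 / g.coeff 0)) := by
  have hne : g.eval 0 ≠ 0 := by rw [← coeff_zero_eq_eval_zero]; exact h0.ne'
  have hroots : ∀ r ∈ g.roots, r < 0 := by
    intro r hr
    by_contra! hr0
    have h1 : g.eval r = 0 := (mem_roots'.1 hr).2
    have h2 : g.coeff 0 ≤ g.eval r := by
      rw [eval_eq_sum_range]
      calc g.coeff 0 = g.coeff 0 * r ^ 0 := by simp
        _ ≤ _ := Finset.single_le_sum (f := fun i => g.coeff i * r ^ i)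
          (fun i _ => mul_nonneg (hc i) (pow_nonneg hr0 i)) (by simp)
    linarith
  have hd := hg.eval_derivative_div_eval_of_ne_zero hne
  have hd1 : g.derivative.eval 0 = g.coeff 1 := by
    rw [← coeff_zero_eq_eval_zero, coeff_derivative]; simp
  rw [hd1, ← coeff_zero_eq_eval_zero] at hd
  rw [hd]
  -- Each factor satisfies `t - a = (-a)(1 + t/(-a)) ≤ (-a) exp(t/(-a))`, and the `1/(-a)` add up to
  -- `g'(0)/g(0)`.
  have key : ∀ s : Multiset ℝ, (∀ r ∈ s, r < 0) →
      0 ≤ (s.map fun a => t - a).prod ∧ (s.map fun a => t - a).prod ≤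
      (s.map fun a => 0 - a).prod * Real.exp (t * (s.map fun a => 1 / (0 - a)).sum) := by
    intro s
    induction s using Multiset.induction_on with
    | empty => simp
    | cons a s ih =>
      intro hs
      obtain ⟨h1, h2⟩ := ih fun r hr => hs r (Multiset.mem_cons_of_mem hr)
      have ha : a < 0 := hs a (Multiset.mem_cons_self a s)
      simp only [Multiset.map_cons, Multiset.prod_cons, Multiset.sum_cons]
      refine ⟨mul_nonneg (by linarith) h1, ?_⟩
      have h3 : t - a ≤ (0 - a) * Real.exp (t * (1 / (0 - a))) := by
        have := Real.add_one_le_exp (t * (1 / (0 - a)))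
        have h4 : (0 - a) * (t * (1 / (0 - a)) + 1) = t - a := by
          have : (0 - a) ≠ 0 := by linarith
          field_simp
          ring
        rw [← h4]
        exact mul_le_mul_of_nonneg_left this (by linarith)
      calc (t - a) * (s.map fun a => t - a).prod
          ≤ ((0 - a) * Real.exp (t * (1 / (0 - a)))) * ((s.map fun a => 0 - a).prod *
            Real.exp (t * (s.map fun a => 1 / (0 - a)).sum)) :=
            mul_le_mul h3 h2 h1 (mul_nonneg (by linarith) (Real.exp_pos _).le)
        _ = _ := by rw [mul_add, Real.exp_add]; ring
  have hlc : 0 ≤ g.leadingCoeff := hc _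
  rw [hg.eval_eq_prod_roots t]
  conv_rhs => rw [coeff_zero_eq_eval_zero, hg.eval_eq_prod_roots 0]
  rw [mul_assoc]
  exact mul_le_mul_of_nonneg_left (key _ hroots).2 hlc

/-- The univariate capacity bound: the linear coefficient of a real-rooted polynomial `g` with
nonnegative coefficients is at least `e⁻¹ inf_{t > 0} g(t) / t`. -/
theorem le_exp_one_mul_coeff_one {g : ℝ[X]} (hg : g.Splits) (hc : ∀ k, 0 ≤ g.coeff k) {c : ℝ}
    (h : ∀ t : ℝ, 0 < t → c * t ≤ g.eval t) : c ≤ Real.exp 1 * g.coeff 1 := by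
  have he : 1 ≤ Real.exp 1 := Real.one_le_exp zero_le_one
  rcases (hc 0).eq_or_lt with h0 | h0
  · have hg' : g = X * g.divX := by
      conv_lhs => rw [← X_mul_divX_add g, ← h0]
      simp
    have h1 : ∀ t : ℝ, 0 < t → c ≤ g.divX.eval t := by
      intro t ht
      have := h t ht
      rw [hg', eval_mul, eval_X] at this
      nlinarith
    have h2 : c ≤ g.divX.eval 0 := by
      refine ge_of_tendsto (f := fun t => g.divX.eval t) (x := nhdsWithin (0 : ℝ) (Set.Ioi 0))
        ((g.divX.continuous.tendsto 0).mono_left nhdsWithin_le_nhds) ?_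
      filter_upwards [self_mem_nhdsWithin] with t ht using h1 t ht
    rw [← coeff_zero_eq_eval_zero, coeff_divX] at h2
    nlinarith [hc 1]
  · rcases (hc 1).eq_or_lt with h1 | h1
    · rw [← h1, mul_zero]
      by_contra! hcpos
      have ht : 0 < 2 * g.coeff 0 / c := by positivity
      have h2 := h _ ht
      have h3 := eval_le_mul_exp hg hc h0 ht.le
      rw [← h1] at h3
      simp only [zero_div, mul_zero, Real.exp_zero, mul_one] at h3
      have h4 : c * (2 * g.coeff 0 / c) = 2 * g.coeff 0 := by field_simp
      linarith
    -- This `t` makes the exponent equal to `1`, which minimizes the exponential bound divided by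
    -- `t`.
    · have ht : 0 < g.coeff 0 / g.coeff 1 := by positivity
      have h2 := (h _ ht).trans (eval_le_mul_exp hg hc h0 ht.le)
      have h3 : g.coeff 0 / g.coeff 1 * (g.coeff 1 / g.coeff 0) = 1 := by field_simp
      rw [h3] at h2
      have h4 : g.coeff 0 * Real.exp 1 =
          (Real.exp 1 * g.coeff 1) * (g.coeff 0 / g.coeff 1) := by field_simp
      rw [h4] at h2
      exact le_of_mul_le_mul_right h2 ht

end Univariate

/-! ### Hurwitz stability and hyperbolicity -/

open MvPolynomial

/-- A real polynomial is Hurwitz stable if it has no zero all of whose coordinates have positive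
real part. -/
def IsHurwitzStable {m : ℕ} (p : MvPolynomial (Fin m) ℝ) : Prop :=
  ∀ z : Fin m → ℂ, (∀ i, 0 < (z i).re) → aeval z p ≠ 0

theorem aeval_const_mul {σ A : Type*} [CommRing A] [Algebra ℝ A] {p : MvPolynomial σ ℝ} {d : ℕ}
    (hp : p.IsHomogeneous d) (c : A) (z : σ → A) :
    aeval (fun i => c * z i) p = c ^ d * aeval z p := by
  rw [aeval_def, aeval_def, eval₂_eq, eval₂_eq, Finset.mul_sum]
  refine Finset.sum_congr rfl fun α hα => ?_
  have hd : ∑ i ∈ α.support, α i = d := by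
    have := hp (mem_support_iff.1 hα)
    simpa [Finsupp.weight_apply, Finsupp.sum] using this
  simp_rw [mul_pow, Finset.prod_mul_distrib, Finset.prod_pow_eq_pow_sum, hd]
  ring

theorem aeval_ofReal {σ : Type*} (b : σ → ℝ) (p : MvPolynomial σ ℝ) :
    aeval (fun i => (b i : ℂ)) p = (eval b p : ℂ) := by
  have := aeval_algebraMap_apply ℂ b p
  rw [← coe_aeval_eq_eval]
  exact this

theorem IsRealStable.isHurwitzStable {m d : ℕ} {p : MvPolynomial (Fin m) ℝ}
    (hp : p.IsHomogeneous d) (h : IsRealStable p) : IsHurwitzStable p := by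
  intro z hz h0
  refine h (fun i => Complex.I * z i) (fun i => by simpa using hz i) ?_
  rw [aeval_const_mul hp, h0, mul_zero]

theorem eval_pos {m : ℕ} {p : MvPolynomial (Fin m) ℝ} (hc : NonnegCoeffs p) (h0 : p ≠ 0)
    {b : Fin m → ℝ} (hb : ∀ i, 0 < b i) : 0 < eval b p := by
  rw [eval_eq]
  refine Finset.sum_pos (fun α hα => mul_pos ?_ (Finset.prod_pos fun i _ => pow_pos (hb i) _)) ?_
  · exact lt_of_le_of_ne (hc α) (Ne.symm (mem_support_iff.1 hα))
  · exact Finset.nonempty_of_ne_empty (mt support_eq_empty.1 h0)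

theorem eval_nonneg {m : ℕ} {p : MvPolynomial (Fin m) ℝ} (hc : NonnegCoeffs p)
    {b : Fin m → ℝ} (hb : ∀ i, 0 < b i) : 0 ≤ eval b p := by
  rcases eq_or_ne p 0 with rfl | h0
  · simp
  · exact (eval_pos hc h0 hb).le

/-- Hyperbolicity: a homogeneous Hurwitz stable polynomial is real-rooted on lines through
positive points. -/
theorem IsHurwitzStable.aeval_line_ne_zero {m d : ℕ} {p : MvPolynomial (Fin m) ℝ}
    (hp : p.IsHomogeneous d) (h : IsHurwitzStable p) {b : Fin m → ℝ} (hb : ∀ i, 0 < b i)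
    (a : Fin m → ℝ) {u : ℂ} (hu : u.im ≠ 0) :
    aeval (fun i => (b i : ℂ) + u * a i) p ≠ 0 := by
  intro h0
  -- The factor `i ū` makes the `a`-part purely imaginary; the extra `Im u` makes the real part of
  -- the `b`-part a square times `b`.
  refine h (fun i => (u.im * (Complex.I * starRingEnd ℂ u)) * ((b i : ℂ) + u * a i))
    (fun i => ?_) ?_
  · have : ((u.im * (Complex.I * starRingEnd ℂ u)) * ((b i : ℂ) + u * a i)).re =
        u.im ^ 2 * b i := by
      simp
      ring
    rw [this]
    have := hb i
    positivity
  · rw [aeval_const_mul hp, h0, mul_zero]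

/-- The restriction of a polynomial to the line `u ↦ b + u a`. -/
noncomputable def line {m : ℕ} (p : MvPolynomial (Fin m) ℝ) (b a : Fin m → ℝ) : Polynomial ℝ :=
  aeval (fun i => Polynomial.C (b i) + Polynomial.X * Polynomial.C (a i)) p

theorem aeval_line {m : ℕ} (p : MvPolynomial (Fin m) ℝ) (b a : Fin m → ℝ) {A : Type*} [CommRing A]
    [Algebra ℝ A] (u : A) : Polynomial.aeval u (line p b a) =
      aeval (fun i => algebraMap ℝ A (b i) + u * algebraMap ℝ A (a i)) p := by
  rw [line, ← AlgHom.comp_apply, comp_aeval]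
  refine congrArg (fun f => aeval f p) (funext fun i => ?_)
  simp only [map_add, map_mul, Polynomial.aeval_C, Polynomial.aeval_X]

theorem IsHurwitzStable.splits_line {m d : ℕ} {p : MvPolynomial (Fin m) ℝ}
    (hp : p.IsHomogeneous d) (h : IsHurwitzStable p) {b : Fin m → ℝ} (hb : ∀ i, 0 < b i)
    (a : Fin m → ℝ) : (line p b a).Splits := by
  refine splits_of_forall_im_eq_zero fun z hz => ?_
  by_contra hu
  rw [aeval_line] at hz
  exact h.aeval_line_ne_zero hp hb a hu hz

/-- On the real-rooted line through `Re z` in direction `Im z`, compare the parameters `0` and `i`.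
This quantitative form of stability survives limits. -/
theorem IsHurwitzStable.abs_eval_re_le {m d : ℕ} {p : MvPolynomial (Fin m) ℝ}
    (hp : p.IsHomogeneous d) (h : IsHurwitzStable p) {z : Fin m → ℂ} (hz : ∀ i, 0 < (z i).re) :
    |eval (fun i => (z i).re) p| ≤ ‖aeval z p‖ := by
  have := abs_eval_zero_le_norm_aeval_I (h.splits_line hp hz fun i => (z i).im)
  rw [aeval_line, ← Polynomial.coe_aeval_eq_eval, aeval_line] at this
  have h1 : (fun i => algebraMap ℝ ℂ (z i).re + Complex.I * algebraMap ℝ ℂ (z i).im) = z := by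
    funext i
    rw [mul_comm]
    exact Complex.re_add_im (z i)
  rw [h1] at this
  simpa [coe_aeval_eq_eval] using this

theorem aeval_real_eq_eval {σ : Type*} (x : σ → ℝ) (p : MvPolynomial σ ℝ) :
    aeval x p = eval x p := by
  rw [← coe_aeval_eq_eval]
  rfl

/-! ### Slices and derivatives in the first variable -/

/-- The restriction of `p` to the line of points `(t, z)`, as a polynomial in `t`. -/
noncomputable def slice {n : ℕ} {A : Type*} [CommRing A] [Algebra ℝ A]
    (p : MvPolynomial (Fin (n + 1)) ℝ) (z : Fin n → A) : Polynomial A :=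
  (finSuccEquiv ℝ n p).map (aeval z : MvPolynomial (Fin n) ℝ →ₐ[ℝ] A).toRingHom

theorem eval_slice {n : ℕ} {A : Type*} [CommRing A] [Algebra ℝ A]
    (p : MvPolynomial (Fin (n + 1)) ℝ) (z : Fin n → A) (t : A) :
    (slice p z).eval t = aeval (Fin.cons t z : Fin (n + 1) → A) p := by
  unfold slice
  induction p using MvPolynomial.induction_on with
  | C a => simp [finSuccEquiv_apply]
  | add p q hp hq => simp only [map_add, Polynomial.map_add, Polynomial.eval_add, hp, hq]
  | mul_X p i hp =>
    simp only [map_mul, Polynomial.map_mul, Polynomial.eval_mul, hp, aeval_X]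
    congr 1
    refine Fin.cases ?_ (fun j => ?_) i
    · simp [finSuccEquiv_X_zero]
    · simp [finSuccEquiv_X_succ]

theorem coeff_slice {n : ℕ} {A : Type*} [CommRing A] [Algebra ℝ A]
    (p : MvPolynomial (Fin (n + 1)) ℝ) (z : Fin n → A) (k : ℕ) :
    (slice p z).coeff k = aeval z ((finSuccEquiv ℝ n p).coeff k) := by
  simp [slice]

theorem finSuccEquiv_pderiv_zero {n : ℕ} (p : MvPolynomial (Fin (n + 1)) ℝ) :
    finSuccEquiv ℝ n (pderiv 0 p) = (finSuccEquiv ℝ n p).derivative := by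
  ext k α
  rw [Polynomial.coeff_derivative, finSuccEquiv_coeff_coeff, coeff_pderiv]
  have h1 : ((k : MvPolynomial (Fin n) ℝ) + 1) = MvPolynomial.C ((k : ℝ) + 1) := by simp
  rw [h1, mul_comm _ (C _), coeff_C_mul, finSuccEquiv_coeff_coeff]
  have h2 : Finsupp.cons k α + Finsupp.single 0 1 = Finsupp.cons (k + 1) α := by
    ext i
    refine Fin.cases ?_ (fun j => ?_) i <;> simp
  rw [h2, Finsupp.cons_zero]
  ring

theorem slice_pderiv_zero {n : ℕ} {A : Type*} [CommRing A] [Algebra ℝ A]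
    (p : MvPolynomial (Fin (n + 1)) ℝ) (z : Fin n → A) :
    slice (pderiv 0 p) z = (slice p z).derivative := by
  rw [slice, slice, finSuccEquiv_pderiv_zero, Polynomial.derivative_map]

theorem NonnegCoeffs.finSuccEquiv_coeff {n : ℕ} {p : MvPolynomial (Fin (n + 1)) ℝ}
    (hc : NonnegCoeffs p) (k : ℕ) : NonnegCoeffs ((finSuccEquiv ℝ n p).coeff k) := by
  intro α
  rw [finSuccEquiv_coeff_coeff]
  exact hc _

theorem NonnegCoeffs.pderiv {m : ℕ} {p : MvPolynomial (Fin m) ℝ} (hc : NonnegCoeffs p)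
    (i : Fin m) : NonnegCoeffs (pderiv i p) := by
  intro α
  rw [coeff_pderiv]
  exact mul_nonneg (hc _) (by positivity)

theorem NonnegCoeffs.coeff_slice_nonneg {n : ℕ} {p : MvPolynomial (Fin (n + 1)) ℝ}
    (hc : NonnegCoeffs p) {b : Fin n → ℝ} (hb : ∀ i, 0 < b i) (k : ℕ) :
    0 ≤ (slice p b).coeff k := by
  rw [coeff_slice, aeval_real_eq_eval]
  exact eval_nonneg (hc.finSuccEquiv_coeff k) hb

theorem NonnegCoeffs.coeff_mul_pow_le_eval_cons {n : ℕ} {p : MvPolynomial (Fin (n + 1)) ℝ}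
    (hc : NonnegCoeffs p) {b : Fin n → ℝ} (hb : ∀ i, 0 < b i) {t : ℝ} (ht : 0 ≤ t) (k : ℕ) :
    eval b ((finSuccEquiv ℝ n p).coeff k) * t ^ k ≤ eval (Fin.cons t b : Fin (n + 1) → ℝ) p := by
  have h1 := eval_slice p b t
  rw [aeval_real_eq_eval] at h1
  have h2 := coeff_slice p b k
  rw [aeval_real_eq_eval] at h2
  rw [← h1, ← h2, Polynomial.eval_eq_sum_range' (n := max (slice p b).natDegree k + 1) (by omega)]
  exact Finset.single_le_sum (f := fun i => (slice p b).coeff i * t ^ i)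
    (fun i _ => mul_nonneg (hc.coeff_slice_nonneg hb i) (pow_nonneg ht i))
    (Finset.mem_range.2 (by omega))

theorem cons_pos {n : ℕ} {t : ℝ} {b : Fin n → ℝ} (ht : 0 < t) (hb : ∀ i, 0 < b i) (i : Fin (n + 1)) :
    0 < (Fin.cons t b : Fin (n + 1) → ℝ) i := by
  refine Fin.cases ?_ (fun j => ?_) i
  · simpa using ht
  · simpa using hb j

theorem re_cons_pos {n : ℕ} {t : ℂ} {z : Fin n → ℂ} (ht : 0 < t.re) (hz : ∀ i, 0 < (z i).re)
    (i : Fin (n + 1)) : 0 < ((Fin.cons t z : Fin (n + 1) → ℂ) i).re := by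
  refine Fin.cases ?_ (fun j => ?_) i
  · simpa using ht
  · simpa using hz j

theorem IsHurwitzStable.eval_le_norm_eval_slice {n d : ℕ} {p : MvPolynomial (Fin (n + 1)) ℝ}
    (hp : p.IsHomogeneous d) (hc : NonnegCoeffs p) (h : IsHurwitzStable p) {z : Fin n → ℂ}
    (hz : ∀ i, 0 < (z i).re) {t : ℝ} (ht : 0 < t) (k : ℕ) :
    eval (fun i => (z i).re) ((finSuccEquiv ℝ n p).coeff k) * t ^ k ≤ ‖(slice p z).eval (t : ℂ)‖ := by
  have h1 := h.abs_eval_re_le hp (re_cons_pos (t := (t : ℂ)) (by simpa using ht) hz)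
  rw [← eval_slice] at h1
  have h2 : (fun i => ((Fin.cons (t : ℂ) z : Fin (n + 1) → ℂ) i).re) =
      Fin.cons t fun i => (z i).re := by
    funext i
    refine Fin.cases ?_ (fun j => ?_) i <;> simp
  rw [h2] at h1
  exact (hc.coeff_mul_pow_le_eval_cons hz ht.le k).trans ((le_abs_self _).trans h1)

/-- Differentiating preserves Hurwitz stability, by the Gauss–Lucas theorem. -/
theorem IsHurwitzStable.pderiv_zero {n d : ℕ} {p : MvPolynomial (Fin (n + 1)) ℝ}
    (hp : p.IsHomogeneous d) (hc : NonnegCoeffs p) (h : IsHurwitzStable p)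
    (h1 : (finSuccEquiv ℝ n p).coeff 1 ≠ 0) : IsHurwitzStable (pderiv 0 p) := by
  intro w hw h0
  obtain ⟨t, z, rfl⟩ : ∃ (t : ℂ) (z : Fin n → ℂ), w = Fin.cons t z :=
    ⟨w 0, Fin.tail w, (Fin.cons_self_tail w).symm⟩
  have ht : 0 < t.re := by simpa using hw 0
  have hz : ∀ i, 0 < (z i).re := fun i => by simpa using hw i.succ
  rw [← eval_slice, slice_pderiv_zero] at h0
  have hpos := eval_pos (hc.finSuccEquiv_coeff 1) h1 hz
  -- A constant slice would contradict the lower bound that grows linearly in `t`.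
  have hdeg : 0 < (slice p z).degree := by
    by_contra! hle
    rw [Polynomial.eq_C_of_degree_le_zero hle] at h0
    have hb := fun (s : ℝ) (hs : 0 < s) => h.eval_le_norm_eval_slice hp hc hz hs 1
    rw [Polynomial.eq_C_of_degree_le_zero hle] at hb
    simp only [pow_one, Polynomial.eval_C] at hb
    set a := eval (fun i => (z i).re) ((finSuccEquiv ℝ n p).coeff 1)
    set M := ‖(slice p z).coeff 0‖
    have hM : 0 ≤ M := norm_nonneg _
    have := hb ((M + 1) / a) (by positivity)
    rw [mul_div_cancel₀ _ hpos.ne'] at this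
    linarith
  have hder : (slice p z).derivative ≠ 0 := by
    intro h'
    have := Polynomial.derivative_eq_zero.1 h'
    rw [← Polynomial.natDegree_pos_iff_degree_pos] at hdeg
    omega
  have hmem := Polynomial.rootSet_derivative_subset_convexHull_rootSet hdeg
    (Polynomial.mem_rootSet.2 ⟨hder, by rw [Polynomial.coe_aeval_eq_eval]; exact h0⟩)
  have hsub : convexHull ℝ ((slice p z).rootSet ℂ) ⊆ {s : ℂ | s.re ≤ 0} := by
    refine convexHull_min ?_ (convex_halfSpace_re_le 0)
    intro s hs
    have hs' := (Polynomial.mem_rootSet.1 hs).2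
    rw [Polynomial.coe_aeval_eq_eval, eval_slice] at hs'
    by_contra hpos'
    exact h _ (re_cons_pos (not_le.1 hpos') hz) hs'
  have : t.re ≤ 0 := hsub hmem
  linarith

/-- This coefficient is `∂p/∂x₀` at the boundary point `x₀ = 0`; the lower bound on the derivative
for `t > 0` passes to `t → 0` and stays positive. -/
theorem IsHurwitzStable.finSuccEquiv_coeff_one {n d : ℕ} {p : MvPolynomial (Fin (n + 1)) ℝ}
    (hp : p.IsHomogeneous d) (hc : NonnegCoeffs p) (h : IsHurwitzStable p)
    (h1 : (finSuccEquiv ℝ n p).coeff 1 ≠ 0) :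
    IsHurwitzStable ((finSuccEquiv ℝ n p).coeff 1) := by
  intro z hz h0
  have hq : (finSuccEquiv ℝ n (pderiv 0 p)).coeff 0 = (finSuccEquiv ℝ n p).coeff 1 := by
    rw [finSuccEquiv_pderiv_zero, Polynomial.coeff_derivative]
    simp
  have hst := h.pderiv_zero hp hc h1
  have hpos := eval_pos (hc.finSuccEquiv_coeff 1) h1 hz
  have hlim : eval (fun i => (z i).re) ((finSuccEquiv ℝ n p).coeff 1) ≤
      ‖(slice (pderiv 0 p) z).eval ((0 : ℝ) : ℂ)‖ := by
    have hcont : Continuous fun t : ℝ => ‖(slice (pderiv 0 p) z).eval (t : ℂ)‖ :=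
      ((slice (pderiv 0 p) z).continuous.comp Complex.continuous_ofReal).norm
    refine ge_of_tendsto (f := fun t : ℝ => ‖(slice (pderiv 0 p) z).eval (t : ℂ)‖)
      (x := nhdsWithin (0 : ℝ) (Set.Ioi 0)) ((hcont.tendsto 0).mono_left nhdsWithin_le_nhds) ?_
    filter_upwards [self_mem_nhdsWithin] with t ht
    have := hst.eval_le_norm_eval_slice hp.pderiv (hc.pderiv 0) hz ht 0
    rwa [hq, pow_zero, mul_one] at this
  rw [Complex.ofReal_zero, ← Polynomial.coeff_zero_eq_eval_zero, coeff_slice, hq, h0,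
    norm_zero] at hlim
  linarith

/-! ### Gurvits' inequality -/

/-- Gurvits' capacity inequality: the coefficient of `x₁ ⋯ x_m` in a stable homogeneous polynomial
`p` with nonnegative coefficients is at least `e⁻ᵐ inf_{x > 0} p(x) / (x₁ ⋯ x_m)`. -/
theorem IsHurwitzStable.le_exp_mul_coeff {m d : ℕ} {p : MvPolynomial (Fin m) ℝ}
    (hp : p.IsHomogeneous d) (hc : NonnegCoeffs p) (h : IsHurwitzStable p) {c : ℝ}
    (hcap : ∀ x : Fin m → ℝ, (∀ i, 0 < x i) → c * ∏ i, x i ≤ eval x p) :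
    c ≤ Real.exp 1 ^ m * p.coeff (Finsupp.equivFunOnFinite.symm fun _ => 1) := by
  induction m generalizing d c with
  | zero =>
    have := hcap (fun _ => 1) (fun _ => one_pos)
    rw [eq_C_of_isEmpty p] at this ⊢
    simpa [Subsingleton.elim (Finsupp.equivFunOnFinite.symm fun _ => 1) (0 : Fin 0 →₀ ℕ)] using this
  | succ n ih =>
    set q := (finSuccEquiv ℝ n p).coeff 1 with hq
    have hcoeff : q.coeff (Finsupp.equivFunOnFinite.symm fun _ => 1) =
        p.coeff (Finsupp.equivFunOnFinite.symm fun _ => 1) := by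
      rw [hq, finSuccEquiv_coeff_coeff]
      congr 1
      ext i
      refine Fin.cases ?_ (fun j => ?_) i <;> simp
    have hqcap : ∀ x : Fin n → ℝ, (∀ i, 0 < x i) → c / Real.exp 1 * ∏ i, x i ≤ eval x q := by
      intro x hx
      have hsplit : (slice p x).Splits := by
        refine splits_of_forall_im_eq_zero fun z hz => ?_
        by_contra hu
        -- The base point must be strictly positive, so the line starts at `(1, x)` and the
        -- parameter is shifted to `z - 1`.
        refine h.aeval_line_ne_zero hp (b := Fin.cons 1 x) (cons_pos one_pos hx)
          (Fin.cons 1 0) (u := z - 1) (by simpa using hu) ?_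
        have h1 : Polynomial.aeval z (slice p x) = (slice p fun i => (x i : ℂ)).eval z := by
          rw [← Polynomial.eval_map_algebraMap]
          congr 1
          ext k
          rw [Polynomial.coeff_map, coeff_slice, coeff_slice, aeval_ofReal, aeval_real_eq_eval]
          rfl
        rw [h1, eval_slice] at hz
        rw [← hz]
        congr 2
        funext i
        refine Fin.cases ?_ (fun j => ?_) i <;> simp
      have := le_exp_one_mul_coeff_one hsplit (hc.coeff_slice_nonneg hx)
        (c := c * ∏ i, x i) fun t ht => by
          have := hcap (Fin.cons t x) (cons_pos ht hx)
          rw [Fin.prod_univ_succ] at this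
          rw [eval_slice, aeval_real_eq_eval]
          simp only [Fin.cons_zero, Fin.cons_succ] at this
          refine le_trans (le_of_eq (by ring)) this
      rw [coeff_slice, aeval_real_eq_eval, ← hq] at this
      have he := Real.exp_pos 1
      rw [div_mul_eq_mul_div, div_le_iff₀ he]
      linarith
    rcases eq_or_ne q 0 with h0 | h0
    · have := hqcap (fun _ => 1) fun _ => one_pos
      rw [h0] at this
      simp only [Finset.prod_const_one, mul_one, map_zero] at this
      rw [← hcoeff, h0, coeff_zero, mul_zero]
      have he := Real.exp_pos 1
      rw [div_le_iff₀ he] at this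
      linarith
    · obtain ⟨j, hj⟩ : ∃ j, 1 + j = d := by
        obtain ⟨α, hα⟩ := exists_coeff_ne_zero h0
        rw [hq, finSuccEquiv_coeff_coeff] at hα
        refine ⟨∑ i, α i, ?_⟩
        by_contra hd
        refine hα (hp.coeff_eq_zero ?_)
        rw [Finsupp.degree_eq_sum, Fin.sum_univ_succ]
        simpa using hd
      have := ih (hp.finSuccEquiv_coeff_isHomogeneous 1 j hj) (hc.finSuccEquiv_coeff 1)
        (h.finSuccEquiv_coeff_one hp hc h0) hqcap
      rw [← hq, hcoeff, div_le_iff₀ (Real.exp_pos 1)] at this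
      rw [pow_succ]
      linarith

/-! ### Pairing with the generating polynomial -/

theorem expVec_apply {m : ℕ} (S : Finset (Fin m)) (i : Fin m) :
    expVec S i = if i ∈ S then 1 else 0 := by
  simp [expVec, Finsupp.finsetSum_apply, Finsupp.single_apply]

theorem expVec_add_expVec_compl {m : ℕ} (S : Finset (Fin m)) :
    expVec Sᶜ + expVec S = Finsupp.equivFunOnFinite.symm fun _ => 1 := by
  ext i
  by_cases h : i ∈ S <;> simp [expVec_apply, h]

theorem degree_expVec {m : ℕ} (S : Finset (Fin m)) : (expVec S).degree = S.card := by
  simp [Finsupp.degree_eq_sum, expVec_apply]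

theorem eval_genPoly {m : ℕ} (μ : PMF (Finset (Fin m))) (z : Fin m → ℝ) :
    eval z (genPoly μ) = ∑ S, (μ S).toReal * ∏ i, z i ^ expVec S i := by
  simp only [genPoly, map_sum, eval_monomial, Finsupp.prod_pow]

theorem nonnegCoeffs_genPoly {m : ℕ} (μ : PMF (Finset (Fin m))) : NonnegCoeffs (genPoly μ) := by
  classical
  intro α
  simp only [genPoly, coeff_sum, coeff_monomial]
  refine Finset.sum_nonneg fun S _ => ?_
  split_ifs <;> simp

theorem isHomogeneous_genPoly {m k : ℕ} {μ : PMF (Finset (Fin m))}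
    (h : ∀ S, μ S ≠ 0 → S.card = k) : (genPoly μ).IsHomogeneous k := by
  refine IsHomogeneous.sum _ _ _ fun S _ => ?_
  by_cases hS : μ S = 0
  · simpa [hS] using isHomogeneous_zero _ _ _
  · exact isHomogeneous_monomial _ ((degree_expVec S).trans (h S hS))

theorem NonnegCoeffs.mul {m : ℕ} {p q : MvPolynomial (Fin m) ℝ} (hp : NonnegCoeffs p)
    (hq : NonnegCoeffs q) : NonnegCoeffs (p * q) := by
  classical
  intro α
  rw [coeff_mul]
  exact Finset.sum_nonneg fun x _ => mul_nonneg (hp _) (hq _)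

theorem IsRealStable.mul {m : ℕ} {p q : MvPolynomial (Fin m) ℝ} (hp : IsRealStable p)
    (hq : IsRealStable q) : IsRealStable (p * q) := by
  intro z hz
  rw [map_mul]
  exact mul_ne_zero (hp z hz) (hq z hz)

/-- Multiplying by a distribution supported on the complements of the members of `𝓑` and
extracting the coefficient of `x₁ ⋯ x_m` yields at most `p_𝓑`. -/
theorem coeff_mul_genPoly_le {m : ℕ} {𝓑 : Finset (Finset (Fin m))} {μ : PMF (Finset (Fin m))}
    (hμ : ∀ S, μ S ≠ 0 → Sᶜ ∈ 𝓑) {p : MvPolynomial (Fin m) ℝ} (hp : NonnegCoeffs p) :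
    (p * genPoly μ).coeff (Finsupp.equivFunOnFinite.symm fun _ => 1) ≤ coeffSum 𝓑 p := by
  classical
  have h1 : ∀ S : Finset (Fin m), (p * monomial (expVec S) (μ S).toReal).coeff
      (Finsupp.equivFunOnFinite.symm fun _ => 1) = p.coeff (expVec Sᶜ) * (μ S).toReal := by
    intro S
    rw [← expVec_add_expVec_compl S, coeff_mul_monomial]
  rw [genPoly, Finset.mul_sum, coeff_sum, coeffSum]
  simp_rw [h1]
  have h2 : ∑ S, p.coeff (expVec Sᶜ) * (μ S).toReal = ∑ S, p.coeff (expVec S) * (μ Sᶜ).toReal :=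
    Fintype.sum_bijective compl compl_bijective _ _ fun S => by rw [compl_compl]
  rw [h2]
  rw [← Finset.sum_subset (Finset.subset_univ 𝓑)]
  · refine Finset.sum_le_sum fun S _ => mul_le_of_le_one_right (hp _) ?_
    exact ENNReal.toReal_le_of_le_ofReal zero_le_one (by simpa using μ.coe_le_one Sᶜ)
  · intro S _ hS
    have : μ Sᶜ = 0 := by
      by_contra h
      exact hS (by simpa using hμ _ h)
    simp [this]

/-- If `μ` gives every complement of a member of `𝓑` mass at least `ε`, then its generating
polynomial dominates `ε z^(1 - θ)` for `θ ∈ P(𝓑)`. -/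
theorem mul_prod_le_eval_genPoly_mul {m : ℕ} {𝓑 : Finset (Finset (Fin m))}
    {μ : PMF (Finset (Fin m))} {ε : ℝ} (hε : ∀ S ∈ 𝓑, ε ≤ (μ Sᶜ).toReal) {θ : Fin m → ℝ}
    (hθ : θ ∈ polytope 𝓑) {z : Fin m → ℝ} (hz : ∀ i, 0 < z i) (hε0 : 0 ≤ ε) :
    ε * ∏ i, z i ≤ eval z (genPoly μ) * ∏ i, z i ^ θ i := by
  have hprod : ∀ θ : Fin m → ℝ, ∏ i, z i ^ θ i = Real.exp (∑ i, θ i * Real.log (z i)) := by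
    intro θ
    rw [Real.exp_sum]
    exact Finset.prod_congr rfl fun i _ => by rw [Real.rpow_def_of_pos (hz i), mul_comm]
  have hZ : 0 < ∏ i, z i := Finset.prod_pos fun i _ => hz i
  have hrw : ∀ θ : Fin m → ℝ, (ε * ∏ i, z i ≤ eval z (genPoly μ) * ∏ i, z i ^ θ i) ↔
      ε * (∏ i, z i) * Real.exp (∑ i, (-Real.log (z i)) * θ i) ≤ eval z (genPoly μ) := by
    intro θ
    have : ∑ i, (-Real.log (z i)) * θ i = -∑ i, θ i * Real.log (z i) := by
      rw [← Finset.sum_neg_distrib]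
      exact Finset.sum_congr rfl fun i _ => by ring
    rw [hprod, this, Real.exp_neg, ← div_eq_mul_inv, div_le_iff₀ (Real.exp_pos _)]
  set s : Set (Fin m → ℝ) := {θ | ε * (∏ i, z i) *
    Real.exp (∑ i, (-Real.log (z i)) * θ i) ≤ eval z (genPoly μ)} with hs
  -- `z^(-θ)` is convex in `θ`, so only the vertices `1_S` matter; there the single term `Sᶜ` of the
  -- generating polynomial suffices.
  have hconv : Convex ℝ s := by
    have h1 : ConvexOn ℝ Set.univ fun θ : Fin m → ℝ =>
        Real.exp (∑ i, (-Real.log (z i)) * θ i) :=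
      convexOn_exp.comp_linearMap (∑ i, (-Real.log (z i)) • LinearMap.proj i : (Fin m → ℝ) →ₗ[ℝ] ℝ)
        |>.congr (fun θ _ => by simp)
    have h2 := (h1.smul (c := ε * ∏ i, z i) (by positivity)).convex_le (eval z (genPoly μ))
    simpa [hs] using h2
  have hmem : θ ∈ s := by
    refine convexHull_min ?_ hconv hθ
    rintro _ ⟨S, hS, rfl⟩
    refine (hrw _).1 ?_
    rw [eval_genPoly, Finset.sum_mul]
    have hterm : (μ Sᶜ).toReal * (∏ i, z i ^ expVec Sᶜ i) *
        ∏ i, z i ^ (if i ∈ S then (1 : ℝ) else 0) = (μ Sᶜ).toReal * ∏ i, z i := by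
      rw [mul_assoc, ← Finset.prod_mul_distrib]
      congr 1
      refine Finset.prod_congr rfl fun i _ => ?_
      by_cases hi : i ∈ S <;> simp [expVec_apply, hi]
    calc ε * ∏ i, z i ≤ (μ Sᶜ).toReal * ∏ i, z i :=
          mul_le_mul_of_nonneg_right (hε S hS) hZ.le
      _ = _ := hterm.symm
      _ ≤ _ := Finset.single_le_sum (f := fun T => (μ T).toReal * (∏ i, z i ^ expVec T i) *
            ∏ i, z i ^ (if i ∈ S then (1 : ℝ) else 0))
          (fun T _ => mul_nonneg (mul_nonneg ENNReal.toReal_nonneg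
            (Finset.prod_nonneg fun i _ => pow_nonneg (hz i).le _))
            (Finset.prod_nonneg fun i _ => Real.rpow_nonneg (hz i).le _)) (Finset.mem_univ Sᶜ)
  exact (hrw θ).2 hmem

theorem capacity_le {m n k : ℕ} {𝓑 : Finset (Finset (Fin m))} {μ : PMF (Finset (Fin m))}
    (hSR : IsStronglyRayleigh μ) (hμ : ∀ S, μ S ≠ 0 → Sᶜ ∈ 𝓑) (hk : ∀ S, μ S ≠ 0 → S.card = k)
    {ε : ℝ} (hε0 : 0 < ε) (hε : ∀ S ∈ 𝓑, ε ≤ (μ Sᶜ).toReal) {p : MvPolynomial (Fin m) ℝ}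
    (hc : NonnegCoeffs p) (hst : IsRealStable p) (hp : p.IsHomogeneous n) :
    capacity 𝓑 p ≤ ((coeffSum 𝓑 p * (Real.exp 1 ^ m / ε) : ℝ) : EReal) := by
  refine iSup₂_le fun θ hθ => ?_
  by_contra! hlt
  -- A real `c` replaces the extended-real infimum.
  obtain ⟨c, hc1, hc2⟩ := EReal.lt_iff_exists_real_btwn.1 hlt
  have hc1 := EReal.coe_lt_coe_iff.1 hc1
  have hhom := hp.mul (isHomogeneous_genPoly hk)
  have hcap := ((hst.mul hSR).isHurwitzStable hhom).le_exp_mul_coeff hhom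
    (hc.mul (nonnegCoeffs_genPoly μ)) (c := c * ε) fun z hz => by
      have h1 : (c : EReal) < ((eval z p / ∏ i, z i ^ θ i : ℝ) : EReal) :=
        hc2.trans_le (iInf₂_le z hz)
      have h1 := (EReal.coe_lt_coe_iff.1 h1).le
      have hpos : 0 < ∏ i, z i ^ θ i := Finset.prod_pos fun i _ => Real.rpow_pos_of_pos (hz i) _
      have h2 := mul_prod_le_eval_genPoly_mul hε hθ hz hε0.le
      have hc0 : 0 ≤ c := by
        refine le_trans (mul_nonneg (Finset.sum_nonneg fun S _ => hc _) ?_) hc1.le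
        positivity
      rw [map_mul]
      calc c * ε * ∏ i, z i = c * (ε * ∏ i, z i) := by ring
        _ ≤ c * (eval z (genPoly μ) * ∏ i, z i ^ θ i) := mul_le_mul_of_nonneg_left h2 hc0
        _ = (c * ∏ i, z i ^ θ i) * eval z (genPoly μ) := by ring
        _ ≤ eval z p * eval z (genPoly μ) :=
          mul_le_mul_of_nonneg_right ((le_div_iff₀ hpos).1 h1)
            (eval_nonneg (nonnegCoeffs_genPoly μ) hz)
  have h3 := hcap.trans (mul_le_mul_of_nonneg_left (coeff_mul_genPoly_le hμ hc) (by positivity))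
  rw [← mul_div_assoc, div_lt_iff₀ hε0] at hc1
  linarith

end MatroidCapacity

theorem theorem1 {m n : ℕ} (M : Matroid (Fin m)) (hE : M.E = Set.univ)
    (𝓑 : Finset (Finset (Fin m)))
    (h𝓑 : ∀ S : Finset (Fin m), S ∈ 𝓑 ↔ M.IsBase (S : Set (Fin m)))
    (hn : ∀ S ∈ 𝓑, S.card = n)
    (hSR : ∃ μ : PMF (Finset (Fin m)), MatroidCapacity.IsStronglyRayleigh μ ∧
      μ.support = {S : Finset (Fin m) | M.dual.IsBase (S : Set (Fin m))}) :
    MatroidCapacity.approxRatio n 𝓑 < ⊤ := by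
  classical
  obtain ⟨μ, hμ, hsupp⟩ := hSR
  have hmem : ∀ S, μ S ≠ 0 ↔ Sᶜ ∈ 𝓑 := by
    intro S
    rw [← PMF.mem_support_iff, hsupp, Set.mem_ofPred_eq, h𝓑, Finset.coe_compl,
      Matroid.dual_isBase_iff (hE ▸ Set.subset_univ _), hE, Set.compl_eq_univ_sdiff]
  have hcard : ∀ S, μ S ≠ 0 → S.card = m - n := by
    intro S hS
    have h1 := hn _ ((hmem S).1 hS)
    have h2 := Finset.card_add_card_compl S
    rw [Fintype.card_fin] at h2
    omega
  have hne : 𝓑.Nonempty := by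
    obtain ⟨S, hS⟩ := μ.support_nonempty
    exact ⟨Sᶜ, (hmem S).1 ((μ.mem_support_iff S).1 hS)⟩
  -- The least mass is positive because the support contains every complement of a base.
  obtain ⟨T, hT, hmin⟩ := 𝓑.exists_min_image (fun S => (μ Sᶜ).toReal) hne
  have hε : 0 < (μ Tᶜ).toReal :=
    ENNReal.toReal_pos ((hmem _).2 (by simpa using hT)) (μ.apply_ne_top _)
  refine lt_of_le_of_lt (iSup₂_le fun p hp => ?_)
    (EReal.coe_lt_top (Real.exp 1 ^ m / (μ Tᶜ).toReal))
  obtain ⟨hc, hst, hhom, hpos⟩ := hp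
  rw [EReal.div_le_iff_le_mul (EReal.coe_pos.2 hpos) (EReal.coe_ne_top _), ← EReal.coe_mul]
  exact MatroidCapacity.capacity_le hμ (fun S hS => (hmem S).1 hS) hcard hε hmin hc hst hhom
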